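/- Let $L_R,L_T\ge 1$, $0\le s\le N$ and $K\ge 1$ be integers. Let $\mathbf H_1,\dots,\mathbf H_N\in\mathbb C^{L_R\times L_T}$ be random matrices all of whose entries are i.i.d. circularly symmetric complex Gaussian $\mathcal{CN}(0,1)$. A random vector is called isotropically distributed on the unit sphere of $\mathbb C^n$ if its law is the unique probability measure carried by the unit sphere that is invariant under all unitary matrices. Let $\mathcal B=\{\mathbf B^{(1)},\dots,\mathbf B^{(K)}\}$ be a random codebook, independent of the $\mathbf H_i$, where $\mathbf B^{(j)}=[\mathbf b^{(j)}_1\cdots\mathbf b^{(j)}_s]$ and all the columns $\mathbf b^{(j)}_k$ ($1\le j\le K$, $1\le k\le s$) are independent and isotropically distributed on the unit sphere of $\mathbb C^{L_T}$. The general beamforming scheme is the following. Order the channel matrices by Frobenius norm, $\|\mathbf H_{(1:N)}\|\le\cdots\le\|\mathbf H_{(N:N)}\|$ (ties broken arbitrarily). For $1\le k\le s$ take a singular value decomposition $\mathbf H_{(N-k+1:N)}=\mathbf U_k\mathbf\Lambda_k\mathbf V_k^\dagger$ with decreasingly ordered singular values, and let $\mathbf v_k$ be the first column of $\mathbf V_k$.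 Let $\mathbf B=[\mathbf b_1\cdots\mathbf b_s]$ be a codeword of $\mathcal B$ that maximizes $\sum_{k=1}^s|\mathbf v_k^\dagger\mathbf b_k|^2$; ties are broken by a measurable rule that depends only on the codebook and on the lines spanned by $\mathbf v_1,\dots,\mathbf v_s$. Define the equivalent channels $\tilde{\mathbf h}_k=\mathbf H_{(N-k+1:N)}\mathbf b_k\in\mathbb C^{L_R}$, their norms $n_k=\|\tilde{\mathbf h}_k\|$ and their directions $\boldsymbol\xi_k=\tilde{\mathbf h}_k/n_k$ (well defined almost surely). Then $\boldsymbol\xi_1,\dots,\boldsymbol\xi_s$ are independent and each of them is isotropically distributed on the unit sphere of $\mathbb C^{L_R}$. Furthermore, the family $(\boldsymbol\xi_1,\dots,\boldsymbol\xi_s)$ is independent of the family $(n_1,\dots,n_s)$. -/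

import Mathlib

open MeasureTheory ProbabilityTheory
open scoped Matrix

noncomputable section

namespace Beamforming

/-- Complex column vectors of length `n`, with the Euclidean (Hermitian) norm. -/
abbrev CVec (n : ℕ) : Type := EuclideanSpace ℂ (Fin n)

/-- The circularly symmetric complex Gaussian law `CN(0,1)`: the real and imaginary parts are
independent centred real Gaussians of variance `1/2`. -/
def complexGaussian : Measure ℂ :=
  ((gaussianReal 0 (1 / 2)).prod (gaussianReal 0 (1 / 2))).map
    Complex.measurableEquivRealProd.symm

/-- The isotropic law on the unit sphere of `ℂⁿ`, regarded as a measure on `ℂⁿ`: the probability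
measure that is carried by the unit sphere and is invariant under the unitary group. -/
structure IsIsotropic {n : ℕ} (μ : Measure (CVec n)) : Prop where
  isProbabilityMeasure : IsProbabilityMeasure μ
  ae_mem_sphere : ∀ᵐ x ∂μ, x ∈ Metric.sphere (0 : CVec n) 1
  map_unitary : ∀ T : CVec n ≃ₗᵢ[ℂ] CVec n, μ.map T = μ

/-- The random vector `X` is isotropically distributed on the unit sphere. -/
structure IsotropicallyDistributed {Ω : Type*} [MeasurableSpace Ω] {n : ℕ}
    (X : Ω → CVec n) (P : Measure Ω) : Prop where
  aemeasurable : AEMeasurable X P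
  isIsotropic : IsIsotropic (P.map X)

/-- Rayleigh fading: all entries of all the channel matrices `H 0, …, H (N-1)` are i.i.d.
`CN(0,1)`. -/
structure IsRayleighFading {Ω : Type*} [MeasurableSpace Ω] {LR LT N : ℕ}
    (H : Fin N → Ω → Matrix (Fin LR) (Fin LT) ℂ) (P : Measure Ω) : Prop where
  hasLaw : ∀ i a b, HasLaw (fun ω => H i ω a b) complexGaussian P
  iIndepFun : iIndepFun
    (fun (p : Fin N × Fin LR × Fin LT) (ω : Ω) => H p.1 ω p.2.1 p.2.2) P

/-- A random code book of `K` code words `[C j 0, …, C j (s-1)]` generated from the isotropic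
distribution: the columns of all the code words are independent and isotropically distributed
(so that the code words are independent and each follows the product of the isotropic laws). -/
structure IsIsotropicCodebook {Ω : Type*} [MeasurableSpace Ω] {LT s K : ℕ}
    (C : Ω → Fin K → Fin s → CVec LT) (P : Measure Ω) : Prop where
  isotropic : ∀ j k, IsotropicallyDistributed (fun ω => C ω j k) P
  iIndepFun : iIndepFun (fun (p : Fin K × Fin s) (ω : Ω) => C ω p.1 p.2) P

/-- Frobenius norm of a matrix. -/
def frobeniusNorm {m n : ℕ} (A : Matrix (Fin m) (Fin n) ℂ) : ℝ :=
  Real.sqrt (∑ a, ∑ b, ‖A a b‖ ^ 2)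

/-- `τ` lists the channel matrices in the order of nondecreasing Frobenius norm (ties are broken
arbitrarily). -/
def IsSorting {LR LT N : ℕ} (A : Fin N → Matrix (Fin LR) (Fin LT) ℂ)
    (τ : Equiv.Perm (Fin N)) : Prop :=
  Monotone fun i => frobeniusNorm (A (τ i))

/-- The channel matrix of the `k`-th on-user, i.e. the one of `k`-th largest Frobenius norm
(counting from `k = 0`). -/
def selected {LR LT N s : ℕ} (hs : s ≤ N) (A : Fin N → Matrix (Fin LR) (Fin LT) ℂ)
    (τ : Equiv.Perm (Fin N)) (k : Fin s) : Matrix (Fin LR) (Fin LT) ℂ :=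
  A (τ (Fin.rev (Fin.castLE hs k)))

/-- `A = U Λ Vᴴ` is a singular value decomposition, where the diagonal entries `d 0 ≥ d 1 ≥ …` of
the rectangular diagonal matrix `Λ` are nonnegative and ordered decreasingly. -/
structure IsSVD {m n : ℕ} (A : Matrix (Fin m) (Fin n) ℂ)
    (U : Matrix (Fin m) (Fin m) ℂ) (d : ℕ → ℝ) (V : Matrix (Fin n) (Fin n) ℂ) : Prop where
  left_unitary : U ∈ Matrix.unitaryGroup (Fin m) ℂ
  right_unitary : V ∈ Matrix.unitaryGroup (Fin n) ℂ
  nonneg : ∀ i, 0 ≤ d i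
  antitone : Antitone d
  eq_mul : A = U * Matrix.of
    (fun (a : Fin m) (b : Fin n) => if (a : ℕ) = (b : ℕ) then (d a : ℂ) else 0) * Vᴴ

/-- The column of `V` that belongs to the largest singular value, i.e. the first one. -/
def firstColumn {n : ℕ} [NeZero n] (V : Matrix (Fin n) (Fin n) ℂ) : CVec n :=
  WithLp.toLp 2 fun a => V a 0

/-- `φ B v` is the index of the code word that quantizes `v = [v 0, …, v (s-1)]` with the code
book `B`: a maximizer `j` of `∑ k, |(v k)ᴴ (B j k)|²`. Ties may be broken in any measurable way
that depends on `v` only through the lines spanned by its columns, so that `φ B` is a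
quantization function on the composite Grassmann manifold. -/
structure IsQuantizer {LT s K : ℕ}
    (φ : (Fin K → Fin s → CVec LT) → (Fin s → CVec LT) → Fin K) : Prop where
  measurable : Measurable (Function.uncurry φ)
  isMax : ∀ (B : Fin K → Fin s → CVec LT) (v : Fin s → CVec LT),
    (∀ j k, ‖B j k‖ = 1) → (∀ k, ‖v k‖ = 1) → ∀ j,
    ∑ k, ‖inner ℂ (v k) (B j k)‖ ^ 2 ≤ ∑ k, ‖inner ℂ (v k) (B (φ B v) k)‖ ^ 2
  phase_invariant : ∀ (B : Fin K → Fin s → CVec LT) (v : Fin s → CVec LT),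
    (∀ j k, ‖B j k‖ = 1) → (∀ k, ‖v k‖ = 1) → ∀ z : Fin s → ℂ, (∀ k, ‖z k‖ = 1) → φ B (fun k => z k • v k) = φ B v

/-- The product of a matrix and a column vector. -/
def applyVec {m n : ℕ} (A : Matrix (Fin m) (Fin n) ℂ) (b : CVec n) : CVec m :=
  WithLp.toLp 2 (A *ᵥ b.ofLp)

/-- The equivalent channel of the `k`-th on-user: its channel matrix applied to the `k`-th column
of the code word that the quantizer selects for the strongest right singular vectors
of the on-users. -/
def equivChannel {LR LT N s K : ℕ} [NeZero LT] (hs : s ≤ N)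
    (φ : (Fin K → Fin s → CVec LT) → (Fin s → CVec LT) → Fin K)
    (A : Fin N → Matrix (Fin LR) (Fin LT) ℂ) (τ : Equiv.Perm (Fin N))
    (V : Fin s → Matrix (Fin LT) (Fin LT) ℂ) (B : Fin K → Fin s → CVec LT) (k : Fin s) :
    CVec LR :=
  applyVec (selected hs A τ k) (B (φ B fun l => firstColumn (V l)) k)

/-- The normalization `h / ‖h‖`. -/
def direction {n : ℕ} (h : CVec n) : CVec n := (‖h‖⁻¹ : ℝ) • h

end Beamforming

end

/-! The joint law of the equivalent channels is invariant under independent unitary rotations of its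
`s` components; with almost sure nonvanishing, this forces the conclusion. Left multiplication of
each channel matrix by its own unitary preserves the Gaussian law, the Frobenius norms and the
strongest right singular vectors, hence the user order and the chosen codeword; it only rotates the
equivalent channels. The unitary wanted for a user depends on its rank, but ranks are preserved too,
so the maps for the different orders glue to one measure preserving map
(`map_rotate_map_equivChannels`).

Given the invariance, restrict to the event that the norms lie in some set: the directions still
have a rotation-invariant law on a product of spheres. Such a law is unique up to mass
(`smul_eq_smul_of_invariant`), so it is the same product of isotropic laws whatever the set
(`map_direction_restrict_norm`).

Neither the sorting nor the singular value decompositions are assumed measurable. Ties of Frobenius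
norms are null. By Rademacher's theorem the operator norm is differentiable almost everywhere, and
there its gradient determines the top right singular vector up to a phase
(`exists_measurable_isTopSingularVector`), which the quantizer ignores. -/

namespace Beamforming

open scoped RealInnerProductSpace

/-! ### Uniqueness of invariant measures on products of spheres -/

section Uniqueness

variable {ι E : Type*} [Fintype ι] [NormedAddCommGroup E] [InnerProductSpace ℝ E]
  [FiniteDimensional ℝ E] [MeasurableSpace E] [BorelSpace E]

/-- Transitivity gives `T k` in `G` carrying `y k` to the direction of `t k`; invariance of `m`
absorbs these isometries. The point is that the right-hand side does not involve `y`. -/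
theorem integral_radial_kernel_eq_charFun {G : Set (E ≃ₗᵢ[ℝ] E)}
    (hG : ∀ x y : E, ‖x‖ = 1 → ‖y‖ = 1 → ∃ T ∈ G, T x = y)
    {m : Measure (ι → E)}
    (hm : ∀ T : ι → E ≃ₗᵢ[ℝ] E, (∀ k, T k ∈ G) → m.map (fun x k => T k (x k)) = m)
    (t : PiLp 2 fun _ : ι => E) {y : ι → E} (hy : ∀ k, ‖y k‖ = 1) :
    ∫ x, Complex.exp ((∑ k, ‖t k‖ * ⟪x k, y k⟫ : ℝ) * Complex.I) ∂m =
      charFun (m.map (WithLp.toLp 2)) t := by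
  have hT : ∀ k, ∃ T ∈ G, ‖t k‖ • T (y k) = t k := by
    intro k
    by_cases h : t k = 0
    · obtain ⟨T, hT, -⟩ := hG (y k) (y k) (hy k) (hy k)
      exact ⟨T, hT, by simp [h]⟩
    · obtain ⟨T, hT, h2⟩ := hG (y k) (‖t k‖⁻¹ • t k) (hy k) (by
        rw [norm_smul, norm_inv, norm_norm, inv_mul_cancel₀ (norm_ne_zero_iff.2 h)])
      exact ⟨T, hT, by rw [h2, smul_inv_smul₀ (norm_ne_zero_iff.2 h)]⟩
  choose T hTG hTy using hT
  have hmeas : Measurable fun (x : ι → E) k => T k (x k) :=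
    measurable_pi_lambda _ fun k => (T k).continuous.measurable.comp (measurable_pi_apply k)
  conv_rhs =>
    rw [← hm T hTG, Measure.map_map (by fun_prop) hmeas, charFun_apply,
      integral_map (WithLp.measurable_toLp 2 _ |>.comp hmeas).aemeasurable (by fun_prop)]
  congr with x
  congr 3
  rw [PiLp.inner_apply]
  refine Finset.sum_congr rfl fun k _ => ?_
  conv_rhs => rw [← hTy k]
  simp [inner_smul_right]

/-- Two finite measures carried by a product of unit spheres and invariant under all products of
isometries from a family that is transitive on the unit sphere are proportional. -/
theorem smul_eq_smul_of_invariant {G : Set (E ≃ₗᵢ[ℝ] E)}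
    (hG : ∀ x y : E, ‖x‖ = 1 → ‖y‖ = 1 → ∃ T ∈ G, T x = y)
    {m₁ m₂ : Measure (ι → E)} [IsFiniteMeasure m₁] [IsFiniteMeasure m₂]
    (h₁ : ∀ T : ι → E ≃ₗᵢ[ℝ] E, (∀ k, T k ∈ G) → m₁.map (fun x k => T k (x k)) = m₁)
    (h₂ : ∀ T : ι → E ≃ₗᵢ[ℝ] E, (∀ k, T k ∈ G) → m₂.map (fun x k => T k (x k)) = m₂)
    (s₁ : ∀ᵐ x ∂m₁, ∀ k, ‖x k‖ = 1) (s₂ : ∀ᵐ x ∂m₂, ∀ k, ‖x k‖ = 1) :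
    m₂ Set.univ • m₁ = m₁ Set.univ • m₂ := by
  have key : ∀ t : PiLp 2 fun _ : ι => E,
      (m₂.real Set.univ : ℂ) * charFun (m₁.map (WithLp.toLp 2)) t =
        m₁.real Set.univ * charFun (m₂.map (WithLp.toLp 2)) t := by
    intro t
    -- The kernel is symmetric in `x` and `y`, so integrating it in the two orders yields the
    -- characteristic function of either measure times the mass of the other.
    have e₁ : ∫ y, ∫ x, Complex.exp ((∑ k, ‖t k‖ * ⟪x k, y k⟫ : ℝ) * Complex.I) ∂m₁ ∂m₂ =
        (m₂.real Set.univ : ℂ) * charFun (m₁.map (WithLp.toLp 2)) t := by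
      rw [integral_congr_ae (g := fun _ => charFun (m₁.map (WithLp.toLp 2)) t)]
      · simp
      · filter_upwards [s₂] with y hy
        exact integral_radial_kernel_eq_charFun hG h₁ t hy
    have e₂ : ∫ x, ∫ y, Complex.exp ((∑ k, ‖t k‖ * ⟪x k, y k⟫ : ℝ) * Complex.I) ∂m₂ ∂m₁ =
        (m₁.real Set.univ : ℂ) * charFun (m₂.map (WithLp.toLp 2)) t := by
      rw [integral_congr_ae (g := fun _ => charFun (m₂.map (WithLp.toLp 2)) t)]
      · simp
      · filter_upwards [s₁] with x hx
        simp_rw [← integral_radial_kernel_eq_charFun hG h₂ t hx, real_inner_comm]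
    rw [← e₁, ← e₂]
    refine integral_integral_swap ?_
    refine (integrable_const (1 : ℝ)).mono (Continuous.aestronglyMeasurable ?_) ?_
    · simp only [Function.uncurry_def]
      fun_prop
    · refine .of_forall fun p => ?_
      simp only [Function.uncurry_def]
      rw [Complex.norm_exp_ofReal_mul_I]
      simp
  have : IsFiniteMeasure (m₂ Set.univ • m₁) := Measure.smul_finite _ (measure_ne_top _ _)
  have : IsFiniteMeasure (m₁ Set.univ • m₂) := Measure.smul_finite _ (measure_ne_top _ _)
  refine (MeasurableEquiv.toLp 2 (ι → E)).map_measurableEquiv_injective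
    (Measure.ext_of_charFun (funext fun t => ?_))
  rw [MeasurableEquiv.coe_toLp, Measure.map_smul, Measure.map_smul]
  have := key t
  simp only [charFun_apply] at this ⊢
  rw [integral_smul_measure, integral_smul_measure]
  simpa [Measure.real] using this

end Uniqueness

/-- The isometry from the line of `x` to that of `y` extends to the whole space, and is onto by
dimension. -/
theorem exists_linearIsometryEquiv_apply_eq {n : ℕ} {x y : CVec n} (hx : ‖x‖ = 1) (hy : ‖y‖ = 1) :
    ∃ T : CVec n ≃ₗᵢ[ℂ] CVec n, T x = y := by
  obtain ⟨T, hT⟩ : ∃ T : CVec n →ₗᵢ[ℂ] CVec n, T x = y := by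
    have hx0 : x ≠ 0 := by rintro rfl; simp at hx
    let e := LinearIsometryEquiv.toSpanUnitSingleton (𝕜 := ℂ) x hx
    let f := LinearIsometry.toSpanSingleton ℂ (CVec n) hy
    refine ⟨(f.comp e.symm.toLinearIsometry).extend, ?_⟩
    have hxe : ((e 1 : Submodule.span ℂ {x}) : CVec n) = x := by
      simp [e]
    have h := LinearIsometry.extend_apply (f.comp e.symm.toLinearIsometry) (e 1)
    rw [hxe] at h
    rw [h]
    simp [f]
  exact ⟨T.toLinearIsometryEquiv rfl, hT⟩

theorem measurable_direction {n : ℕ} : Measurable (direction : CVec n → CVec n) := by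
  unfold direction
  fun_prop

theorem norm_direction {n : ℕ} {x : CVec n} (hx : x ≠ 0) : ‖direction x‖ = 1 := by
  rw [direction, norm_smul, norm_inv, norm_norm, inv_mul_cancel₀ (norm_ne_zero_iff.2 hx)]

theorem direction_map {n : ℕ} (T : CVec n ≃ₗᵢ[ℂ] CVec n) (x : CVec n) :
    direction (T x) = T (direction x) := by
  simp only [direction, T.norm_map]
  exact ((T.toLinearEquiv.toLinearMap.restrictScalars ℝ).map_smul _ _).symm

theorem ae_pi_forall {ι E : Type*} [Fintype ι] [MeasurableSpace E] {μ : ι → Measure E}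
    [∀ i, SigmaFinite (μ i)] {p : ι → E → Prop} (h : ∀ i, ∀ᵐ x ∂μ i, p i x) :
    ∀ᵐ x ∂Measure.pi μ, ∀ i, p i (x i) :=
  ae_all_iff.2 fun i => (Measure.quasiMeasurePreserving_eval μ i).ae (h i)

/-! ### Rotation-invariant laws: directions and norms -/

section Rotation

variable {s n : ℕ}

/-- The action of a family of isometries on a family of vectors. -/
noncomputable def rotate (T : Fin s → CVec n ≃ₗᵢ[ℂ] CVec n) (x : Fin s → CVec n) : Fin s → CVec n :=
  fun k => T k (x k)

theorem measurable_rotate (T : Fin s → CVec n ≃ₗᵢ[ℂ] CVec n) : Measurable (rotate T) :=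
  measurable_pi_lambda _ fun k => (T k).continuous.measurable.comp (measurable_pi_apply k)

theorem measurable_directions : Measurable fun (x : Fin s → CVec n) k => direction (x k) :=
  measurable_pi_lambda _ fun k => measurable_direction.comp (measurable_pi_apply k)

theorem measurable_norms : Measurable fun (x : Fin s → CVec n) k => ‖x k‖ := by fun_prop

theorem measurableSet_norm_eq_one : MeasurableSet {x : Fin s → CVec n | ∀ k, ‖x k‖ = 1} := by
  rw [Set.ofPred_forall]
  exact .iInter fun k => measurableSet_eq_fun (by fun_prop) measurable_const

/-- Characteristic functions use the real inner product, so `G` consists of the real isometries that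
come from complex ones; it is still transitive on the sphere. -/
theorem proportional_of_map_rotate {m₁ m₂ : Measure (Fin s → CVec n)}
    [IsFiniteMeasure m₁] [IsFiniteMeasure m₂]
    (h₁ : ∀ T, m₁.map (rotate T) = m₁) (h₂ : ∀ T, m₂.map (rotate T) = m₂)
    (s₁ : ∀ᵐ x ∂m₁, ∀ k, ‖x k‖ = 1) (s₂ : ∀ᵐ x ∂m₂, ∀ k, ‖x k‖ = 1) :
    m₂ Set.univ • m₁ = m₁ Set.univ • m₂ := by
  let G : Set (CVec n ≃ₗᵢ[ℝ] CVec n) :=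
    {S | ∃ T : CVec n ≃ₗᵢ[ℂ] CVec n, ∀ x, S x = T x}
  have aux : ∀ m : Measure (Fin s → CVec n), (∀ T, m.map (rotate T) = m) →
      ∀ S : Fin s → CVec n ≃ₗᵢ[ℝ] CVec n, (∀ k, S k ∈ G) → m.map (fun x k => S k (x k)) = m := by
    intro m hm S hS
    choose T hT using hS
    rw [show (fun (x : Fin s → CVec n) k => S k (x k)) = rotate T from
      funext fun x => funext fun k => hT k (x k)]
    exact hm T
  refine smul_eq_smul_of_invariant (G := G) ?_ (aux m₁ h₁) (aux m₂ h₂) s₁ s₂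
  intro x y hx hy
  obtain ⟨T, hT⟩ := exists_linearIsometryEquiv_apply_eq hx hy
  exact ⟨{ T.toLinearEquiv.restrictScalars ℝ with norm_map' := T.norm_map }, ⟨T, fun _ => rfl⟩, hT⟩

theorem isIsotropic_map_direction {l : Measure (Fin s → CVec n)} [IsProbabilityMeasure l]
    (hl : ∀ T, l.map (rotate T) = l) (h0 : ∀ᵐ x ∂l, ∀ k, x k ≠ 0) (k : Fin s) :
    IsIsotropic (l.map fun x => direction (x k)) := by
  have hm : Measurable fun x : Fin s → CVec n => direction (x k) :=
    measurable_direction.comp (measurable_pi_apply k)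
  refine ⟨Measure.isProbabilityMeasure_map hm.aemeasurable, ?_, fun T => ?_⟩
  · refine (ae_map_iff hm.aemeasurable Metric.isClosed_sphere.measurableSet).2 ?_
    filter_upwards [h0] with x hx
    simp [norm_direction (hx k)]
  · rw [Measure.map_map T.continuous.measurable hm]
    conv_rhs => rw [← hl fun _ => T, Measure.map_map hm (measurable_rotate _)]
    congr 1
    ext1 x
    simp [rotate, direction_map]

/-- Rotations do not change the norms, so the restricted law remains invariant, and uniqueness
applies. Letting `S` vary gives independence from the norms; `S = univ` gives mutual independence.
-/
theorem map_direction_restrict_norm {l : Measure (Fin s → CVec n)} [IsProbabilityMeasure l]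
    (hl : ∀ T, l.map (rotate T) = l) (h0 : ∀ᵐ x ∂l, ∀ k, x k ≠ 0) {S : Set (Fin s → ℝ)}
    (hS : MeasurableSet S) :
    (l.restrict ((fun x k => ‖x k‖) ⁻¹' S)).map (fun x k => direction (x k)) =
      l ((fun x k => ‖x k‖) ⁻¹' S) •
        Measure.pi fun k => l.map fun x => direction (x k) := by
  have hiso := isIsotropic_map_direction hl h0
  have := fun k => (hiso k).isProbabilityMeasure
  have hS' : MeasurableSet ((fun (x : Fin s → CVec n) k => ‖x k‖) ⁻¹' S) := measurable_norms hS
  have key := proportional_of_map_rotate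
    (m₁ := (l.restrict ((fun x k => ‖x k‖) ⁻¹' S)).map (fun x k => direction (x k)))
    (m₂ := Measure.pi fun k => l.map fun x => direction (x k)) ?_ ?_ ?_ ?_
  · rw [measure_univ, one_smul] at key
    rw [key, Measure.map_apply measurable_directions .univ, Set.preimage_univ,
      Measure.restrict_apply_univ]
  · intro T
    rw [Measure.map_map (measurable_rotate T) measurable_directions]
    conv_rhs => rw [← hl T, Measure.restrict_map (measurable_rotate T) hS',
      Measure.map_map measurable_directions (measurable_rotate T)]
    congr 1
    · ext1 x
      funext k
      simp [rotate, direction_map]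
    · congr 1
      ext x
      simp [rotate]
  · intro T
    have := Measure.pi_map_pi (μ := fun k => l.map fun x => direction (x k))
      (f := fun k => T k) (fun k => (T k).continuous.aemeasurable)
    simp only [(hiso _).map_unitary] at this
    exact this
  · rw [ae_map_iff measurable_directions.aemeasurable]
    · filter_upwards [ae_restrict_of_ae h0] with x hx k
      exact norm_direction (hx k)
    · exact measurableSet_norm_eq_one
  · exact ae_pi_forall fun k => (hiso k).ae_mem_sphere.mono fun x hx =>
      mem_sphere_zero_iff_norm.1 hx

theorem map_directions_norms {l : Measure (Fin s → CVec n)} [IsProbabilityMeasure l]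
    (hl : ∀ T, l.map (rotate T) = l) (h0 : ∀ᵐ x ∂l, ∀ k, x k ≠ 0) :
    l.map (fun x => (fun k => direction (x k), fun k => ‖x k‖)) =
      (Measure.pi fun k => l.map fun x => direction (x k)).prod
        (l.map fun x k => ‖x k‖) := by
  have hiso := isIsotropic_map_direction hl h0
  have := fun k => (hiso k).isProbabilityMeasure
  refine (Measure.prod_eq fun A S hA hS => ?_).symm
  rw [Measure.map_apply (measurable_directions.prodMk measurable_norms) (hA.prod hS),
    Measure.map_apply measurable_norms hS]
  have := congrArg (fun m => m A) (map_direction_restrict_norm hl h0 hS)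
  simp only [Measure.smul_apply, smul_eq_mul] at this
  rw [Measure.map_apply measurable_directions hA,
    Measure.restrict_apply (measurable_directions hA)] at this
  rw [mul_comm, ← this]
  rfl

theorem map_directions {l : Measure (Fin s → CVec n)} [IsProbabilityMeasure l]
    (hl : ∀ T, l.map (rotate T) = l) (h0 : ∀ᵐ x ∂l, ∀ k, x k ≠ 0) :
    l.map (fun x k => direction (x k)) =
      Measure.pi fun k => l.map fun x => direction (x k) := by
  simpa using map_direction_restrict_norm hl h0 .univ

/-- If the joint law of a family of almost surely nonzero vectors is invariant under independent
rotations, then their directions are independent, isotropic and independent of their norms. -/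
theorem isotropic_iIndepFun_indepFun_norm {Ω : Type*} [MeasurableSpace Ω] {P : Measure Ω}
    [IsProbabilityMeasure P] {h : Ω → Fin s → CVec n} (hm : AEMeasurable h P)
    (hl : ∀ T, (P.map h).map (rotate T) = P.map h) (h0 : ∀ᵐ ω ∂P, ∀ k, h ω k ≠ 0) :
    (∀ k, IsotropicallyDistributed (fun ω => direction (h ω k)) P) ∧
      iIndepFun (fun k ω => direction (h ω k)) P ∧
      IndepFun (fun ω k => direction (h ω k)) (fun ω k => ‖h ω k‖) P := by
  have : IsProbabilityMeasure (P.map h) := Measure.isProbabilityMeasure_map hm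
  have h0' : ∀ᵐ x ∂(P.map h), ∀ k, x k ≠ 0 := by
    refine (ae_map_iff hm ?_).2 h0
    rw [Set.ofPred_forall]
    exact .iInter fun k => (measurableSet_eq_fun (measurable_pi_apply k) measurable_const).compl
  have hdk : ∀ k, Measurable fun x : Fin s → CVec n => direction (x k) :=
    fun k => measurable_direction.comp (measurable_pi_apply k)
  have mk : ∀ k, (P.map h).map (fun x => direction (x k)) = P.map fun ω => direction (h ω k) :=
    fun k => AEMeasurable.map_map_of_aemeasurable (hdk k).aemeasurable hm
  have hiso := isIsotropic_map_direction hl h0'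
  have hpi := map_directions hl h0'
  have hprod := map_directions_norms hl h0'
  simp only [mk] at hiso hpi hprod
  rw [AEMeasurable.map_map_of_aemeasurable measurable_directions.aemeasurable hm] at hpi
  rw [AEMeasurable.map_map_of_aemeasurable
      (measurable_directions.prodMk measurable_norms).aemeasurable hm,
    AEMeasurable.map_map_of_aemeasurable measurable_norms.aemeasurable hm] at hprod
  have hdkP : ∀ k, AEMeasurable (fun ω => direction (h ω k)) P :=
    fun k => (hdk k).comp_aemeasurable hm
  refine ⟨fun k => ⟨hdkP k, hiso k⟩, ?_, ?_⟩
  · rw [iIndepFun_iff_map_fun_eq_pi_map hdkP]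
    exact hpi
  · refine (indepFun_iff_map_prod_eq_prod_map_map (measurable_directions.comp_aemeasurable hm)
      (measurable_norms.comp_aemeasurable hm)).2 ?_
    exact hprod.trans (by rw [← hpi])

end Rotation


/-! ### Unitary invariance of the complex Gaussian -/

section Gaussian

theorem charFun_complexGaussian (t : ℂ) :
    charFun complexGaussian t = Complex.exp (-(‖t‖ ^ 2 / 4 : ℝ)) := by
  have hv : ((1 / 2 : NNReal) : ℂ) = 1 / 2 := by norm_num
  rw [complexGaussian, charFun_apply, integral_map_equiv]
  have : ∀ p : ℝ × ℝ, Complex.exp (⟪Complex.measurableEquivRealProd.symm p, t⟫ * Complex.I) =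
      Complex.exp (t.re * p.1 * Complex.I) * Complex.exp (t.im * p.2 * Complex.I) := by
    intro p
    rw [← Complex.exp_add, Complex.inner]
    congr 1
    simp [Complex.measurableEquivRealProd]
    ring
  simp_rw [this]
  rw [integral_prod_mul (fun x : ℝ => Complex.exp (t.re * x * Complex.I))
    (fun y : ℝ => Complex.exp (t.im * y * Complex.I)), ← charFun_apply_real,
    ← charFun_apply_real, charFun_gaussianReal, charFun_gaussianReal, ← Complex.exp_add, hv,
    ← Complex.normSq_eq_norm_sq, Complex.normSq_apply]
  congr 1
  push_cast
  ring

instance : IsProbabilityMeasure complexGaussian :=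
  Measure.isProbabilityMeasure_map Complex.measurableEquivRealProd.symm.measurable.aemeasurable

/-- Carries Lebesgue-almost-everywhere facts about matrix entries over to the random channels. -/
theorem complexGaussian_absolutelyContinuous : complexGaussian ≪ volume := by
  rw [complexGaussian, ← Complex.volume_preserving_equiv_real_prod.symm.map_eq]
  exact ((gaussianReal_absolutelyContinuous 0 (by norm_num)).prod
    (gaussianReal_absolutelyContinuous 0 (by norm_num))).map
      Complex.measurableEquivRealProd.symm.measurable

variable {ι E : Type*} [Fintype ι] [NormedAddCommGroup E] [InnerProductSpace ℝ E]
  [FiniteDimensional ℝ E] [MeasurableSpace E] [BorelSpace E]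

/-- A product of copies of a centred isotropic Gaussian measure is invariant under isometries. -/
theorem measurePreserving_pi_of_charFun {μ : Measure E} [IsFiniteMeasure μ] {c : ℝ}
    (hμ : ∀ t, charFun μ t = Complex.exp (-(‖t‖ ^ 2 / c : ℝ)))
    (f : PiLp 2 (fun _ : ι => E) ≃ₗᵢ[ℝ] PiLp 2 (fun _ : ι => E)) :
    MeasurePreserving (fun x => WithLp.ofLp (f (WithLp.toLp 2 x)))
      (Measure.pi fun _ : ι => μ) (Measure.pi fun _ : ι => μ) := by
  have hf : Measurable f := f.continuous.measurable
  have hchar : ∀ t : PiLp 2 (fun _ : ι => E),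
      charFun ((Measure.pi fun _ : ι => μ).map (WithLp.toLp 2)) t =
        Complex.exp (-(‖t‖ ^ 2 / c : ℝ)) := by
    intro t
    rw [charFun_pi, PiLp.norm_sq_eq_of_L2]
    simp_rw [hμ]
    rw [← Complex.exp_sum, Finset.sum_neg_distrib, Finset.sum_div]
    push_cast
    rfl
  have hmap : ((Measure.pi fun _ : ι => μ).map (WithLp.toLp 2)).map f =
      (Measure.pi fun _ : ι => μ).map (WithLp.toLp 2) := by
    refine Measure.ext_of_charFun (funext fun t => ?_)
    have : charFun (((Measure.pi fun _ : ι => μ).map (WithLp.toLp 2)).map f) t =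
        charFun ((Measure.pi fun _ : ι => μ).map (WithLp.toLp 2)) (f.symm t) := by
      rw [charFun_apply, integral_map hf.aemeasurable (by fun_prop), charFun_apply]
      congr with x
      rw [← f.inner_map_map x (f.symm t), f.apply_symm_apply]
    rw [this, hchar, hchar, f.symm.norm_map]
  have hm : Measurable fun x : ι → E => WithLp.ofLp (f (WithLp.toLp 2 x)) :=
    (WithLp.measurable_ofLp 2 _).comp (hf.comp (WithLp.measurable_toLp 2 _))
  refine ⟨hm, (MeasurableEquiv.toLp 2 (ι → E)).map_measurableEquiv_injective ?_⟩
  rw [MeasurableEquiv.coe_toLp, Measure.map_map (WithLp.measurable_toLp 2 _) hm]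
  rw [Measure.map_map hf (WithLp.measurable_toLp 2 _)] at hmap
  exact hmap

theorem measurePreserving_pi_complexGaussian (f : (ι → ℂ) →ₗ[ℝ] (ι → ℂ))
    (hf : ∀ x, ∑ i, ‖f x i‖ ^ 2 = ∑ i, ‖x i‖ ^ 2) :
    MeasurePreserving f (Measure.pi fun _ : ι => complexGaussian)
      (Measure.pi fun _ : ι => complexGaussian) := by
  let g : PiLp 2 (fun _ : ι => ℂ) →ₗ[ℝ] PiLp 2 (fun _ : ι => ℂ) :=
    (WithLp.linearEquiv 2 ℝ (ι → ℂ)).symm.toLinearMap ∘ₗ f ∘ₗ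
      (WithLp.linearEquiv 2 ℝ (ι → ℂ)).toLinearMap
  have hg : ∀ x, ‖g x‖ = ‖x‖ := by
    intro x
    rw [← sq_eq_sq₀ (norm_nonneg _) (norm_nonneg _), PiLp.norm_sq_eq_of_L2,
      PiLp.norm_sq_eq_of_L2]
    exact hf _
  let h : PiLp 2 (fun _ : ι => ℂ) →ₗᵢ[ℝ] PiLp 2 (fun _ : ι => ℂ) := ⟨g, hg⟩
  exact measurePreserving_pi_of_charFun charFun_complexGaussian (h.toLinearIsometryEquiv rfl)

end Gaussian

/-! ### Gluing and measurable selection -/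

section Measure

theorem pi_absolutelyContinuous {E : Type*} [MeasurableSpace E] {μ ν : Measure E}
    [SigmaFinite μ] [SigmaFinite ν] (h : μ ≪ ν) (ι : Type*) [Fintype ι] :
    (Measure.pi fun _ : ι => μ) ≪ Measure.pi fun _ : ι => ν := by
  have hFin : ∀ n : ℕ, (Measure.pi fun _ : Fin n => μ) ≪ Measure.pi fun _ : Fin n => ν := by
    intro n
    induction n with
    | zero => rw [Measure.pi_of_empty, Measure.pi_of_empty]
    | succ n ih =>
      have h₁ := (measurePreserving_piFinSuccAbove (fun _ : Fin (n + 1) => μ) 0).symm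
      have h₂ := (measurePreserving_piFinSuccAbove (fun _ : Fin (n + 1) => ν) 0).symm
      rw [← h₁.map_eq, ← h₂.map_eq]
      exact (h.prod ih).map (MeasurableEquiv.measurable _)
  let e := (Fintype.equivFin ι).symm
  rw [← (measurePreserving_piCongrLeft (fun _ : ι => μ) e).map_eq,
    ← (measurePreserving_piCongrLeft (fun _ : ι => ν) e).map_eq]
  exact (hFin _).map (MeasurableEquiv.measurable _)

theorem measurable_comp_countable {α β J : Type*} [MeasurableSpace α] [MeasurableSpace β]
    [MeasurableSpace J] [Countable J] [MeasurableSingletonClass J] {π : α → J} (hπ : Measurable π)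
    {F : J → α → β} (hF : ∀ j, Measurable (F j)) : Measurable fun x => F (π x) x :=
  (measurable_from_prod_countable_right hF : Measurable fun p : J × α => F p.1 p.2).comp
    (hπ.prodMk measurable_id)

/-- Measure preserving maps that are chosen according to a finite-valued function which they leave
invariant can be glued. -/
theorem measurePreserving_glue {α J : Type*} [MeasurableSpace α] {μ : Measure α} [Fintype J]
    [MeasurableSpace J] [MeasurableSingletonClass J] {π : α → J} (hπ : Measurable π)
    {θ : J → α → α} (hθ : ∀ j, MeasurePreserving (θ j) μ μ) (h : ∀ j x, π (θ j x) = π x) :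
    MeasurePreserving (fun x => θ (π x) x) μ μ := by
  have hm : Measurable fun x => θ (π x) x :=
    measurable_comp_countable hπ fun j => (hθ j).measurable
  have hsum : ∀ s, MeasurableSet s → μ s = ∑ j, μ (s ∩ π ⁻¹' {j}) := by
    intro s hs
    rw [← measure_biUnion_finset]
    · congr 1
      ext x
      simp
    · intro i _ j _ hij
      refine Set.disjoint_left.2 fun x hx hy => hij ?_
      exact hx.2.symm.trans hy.2
    · exact fun j _ => hs.inter (hπ (measurableSet_singleton j))
  refine ⟨hm, Measure.ext fun s hs => ?_⟩
  rw [Measure.map_apply hm hs, hsum _ (hm hs), hsum s hs]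
  refine Finset.sum_congr rfl fun j _ => ?_
  -- On the fibre over `j` the glued map is `θ j`, which maps neither into nor out of that fibre.
  rw [← (hθ j).measure_preimage (hs.inter (hπ (measurableSet_singleton j))).nullMeasurableSet]
  congr 1
  ext x
  simp only [Set.mem_inter_iff, Set.mem_preimage, Set.mem_singleton_iff, h]
  constructor
  · rintro ⟨hx, rfl⟩
    exact ⟨hx, rfl⟩
  · rintro ⟨hx, rfl⟩
    exact ⟨hx, rfl⟩

/-- Measurable selection among finitely many measurable functions. -/
theorem exists_measurable_selection {α β J : Type*} [MeasurableSpace α] [MeasurableSpace β]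
    [Fintype J] [Nonempty β] {p : J → α → Prop} (hp : ∀ j, MeasurableSet {x | p j x})
    {f : J → α → β} (hf : ∀ j, Measurable (f j)) :
    ∃ g : α → β, Measurable g ∧ ∀ x, (∃ j, p j x) → ∃ j, p j x ∧ g x = f j x := by
  classical
  suffices H : ∀ s : Finset J, ∃ g : α → β, Measurable g ∧
      ∀ x, (∃ j ∈ s, p j x) → ∃ j, p j x ∧ g x = f j x by
    obtain ⟨g, hg, h⟩ := H Finset.univ
    exact ⟨g, hg, fun x ⟨j, hj⟩ => h x ⟨j, Finset.mem_univ j, hj⟩⟩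
  intro s
  induction s using Finset.induction_on with
  | empty => exact ⟨fun _ => Classical.arbitrary β, measurable_const, by simp⟩
  | insert a s _ ih =>
    obtain ⟨g, hg, h⟩ := ih
    refine ⟨fun x => if p a x then f a x else g x, Measurable.ite (hp a) (hf a) hg, ?_⟩
    rintro x ⟨j, hj, hjx⟩
    by_cases hx : p a x
    · exact ⟨a, hx, if_pos hx⟩
    · obtain ⟨i, hi, e⟩ := h x ⟨j, by
        rcases Finset.mem_insert.1 hj with rfl | hj
        · exact absurd hjx hx
        · exact hj, hjx⟩
      exact ⟨i, hi, by simp [hx, e]⟩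

end Measure


/-! ### Strongest right singular vectors -/

section SingularVector

variable {m n : ℕ}

/-- `v` is a right singular vector of `A` for the largest singular value. -/
structure IsTopSingularVector (A : Matrix (Fin m) (Fin n) ℂ) (v : CVec n) : Prop where
  norm_eq_one : ‖v‖ = 1
  norm_le : ∀ w, ‖applyVec A w‖ ≤ ‖applyVec A v‖ * ‖w‖

theorem applyVec_mul {l : ℕ} (A : Matrix (Fin l) (Fin m) ℂ) (B : Matrix (Fin m) (Fin n) ℂ)
    (v : CVec n) : applyVec (A * B) v = applyVec A (applyVec B v) := by
  simp [applyVec]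

theorem norm_applyVec_of_conjTranspose_mul {U : Matrix (Fin m) (Fin n) ℂ} (hU : Uᴴ * U = 1)
    (v : CVec n) : ‖applyVec U v‖ = ‖v‖ := by
  rw [← sq_eq_sq₀ (norm_nonneg _) (norm_nonneg _), ← Complex.ofReal_inj]
  push_cast
  have h₁ := inner_self_eq_norm_sq_to_K (𝕜 := ℂ) (applyVec U v)
  have h₂ := inner_self_eq_norm_sq_to_K (𝕜 := ℂ) v
  simp only [Complex.coe_algebraMap] at h₁ h₂
  rw [← h₁, ← h₂, EuclideanSpace.inner_eq_star_dotProduct, EuclideanSpace.inner_eq_star_dotProduct]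
  simp only [applyVec, Matrix.star_mulVec]
  rw [dotProduct_comm, ← Matrix.dotProduct_mulVec, Matrix.mulVec_mulVec, hU, Matrix.one_mulVec,
    dotProduct_comm]

theorem norm_applyVec_diagonal_le {d : ℕ → ℝ} (h0 : ∀ i, 0 ≤ d i) (hd : Antitone d) (v : CVec n) :
    ‖applyVec (Matrix.of fun (a : Fin m) (b : Fin n) =>
      if (a : ℕ) = (b : ℕ) then (d a : ℂ) else 0) v‖ ≤ d 0 * ‖v‖ := by
  rw [← sq_le_sq₀ (norm_nonneg _) (mul_nonneg (h0 0) (norm_nonneg _)), mul_pow,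
    EuclideanSpace.norm_sq_eq, EuclideanSpace.norm_sq_eq, Finset.mul_sum]
  -- A row has at most one nonzero entry. After the sums are exchanged, each `b` meets at most one
  -- row.
  have hcoord : ∀ a : Fin m, ‖∑ b : Fin n, (if (a : ℕ) = (b : ℕ) then (d a : ℂ) else 0) * v b‖ ^ 2
      ≤ ∑ b : Fin n, if (a : ℕ) = (b : ℕ) then d 0 ^ 2 * ‖v b‖ ^ 2 else 0 := by
    intro a
    by_cases ha : (a : ℕ) < n
    · have hb : ∀ b : Fin n, (a : ℕ) = (b : ℕ) ↔ (⟨a, ha⟩ : Fin n) = b := fun b => by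
        rw [Fin.ext_iff]
      simp only [hb, ite_mul, zero_mul, Finset.sum_ite_eq, Finset.mem_univ, if_true, norm_mul,
        mul_pow]
      gcongr
      rw [Complex.norm_real, Real.norm_of_nonneg (h0 _)]
      exact hd (Nat.zero_le _)
    · have hb : ∀ b : Fin n, ¬ (a : ℕ) = (b : ℕ) := fun b h => ha (h ▸ b.2)
      simp [hb]
  refine (Finset.sum_le_sum fun a _ => hcoord a).trans ?_
  rw [Finset.sum_comm]
  refine Finset.sum_le_sum fun b _ => ?_
  by_cases hb : (b : ℕ) < m
  · have : ∀ a : Fin m, (a : ℕ) = (b : ℕ) ↔ a = (⟨b, hb⟩ : Fin m) := fun a => by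
      rw [Fin.ext_iff]
    simp [this]
  · have : ∀ a : Fin m, ¬ (a : ℕ) = (b : ℕ) := fun a h => hb (h ▸ a.2)
    simp only [this, if_false, Finset.sum_const_zero]
    positivity

/-- The only property of the decomposition that is used. Unitary factors preserve norms, so both
sides reduce to `d 0`. -/
theorem isTopSingularVector_firstColumn [NeZero m] [NeZero n] {A : Matrix (Fin m) (Fin n) ℂ}
    {U : Matrix (Fin m) (Fin m) ℂ} {d : ℕ → ℝ} {V : Matrix (Fin n) (Fin n) ℂ}
    (h : IsSVD A U d V) : IsTopSingularVector A (firstColumn V) := by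
  have hU : Uᴴ * U = 1 := Matrix.mem_unitaryGroup_iff'.1 h.left_unitary
  have hV : Vᴴ * V = 1 := Matrix.mem_unitaryGroup_iff'.1 h.right_unitary
  have hV' : Vᴴᴴ * Vᴴ = 1 := by
    rw [Matrix.conjTranspose_conjTranspose]
    exact Matrix.mem_unitaryGroup_iff.1 h.right_unitary
  have hcol : firstColumn V = applyVec V (EuclideanSpace.single 0 1) := by
    ext a
    simp [firstColumn, applyVec]
  have hnorm : ‖firstColumn V‖ = 1 := by
    rw [hcol, norm_applyVec_of_conjTranspose_mul hV]
    simp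
  have htop : ‖applyVec A (firstColumn V)‖ = d 0 := by
    rw [h.eq_mul, applyVec_mul, applyVec_mul, norm_applyVec_of_conjTranspose_mul hU, hcol,
      ← applyVec_mul Vᴴ, hV]
    have : applyVec (Matrix.of fun (a : Fin m) (b : Fin n) =>
        if (a : ℕ) = (b : ℕ) then (d a : ℂ) else 0)
        (applyVec (1 : Matrix (Fin n) (Fin n) ℂ) (EuclideanSpace.single 0 1)) =
        EuclideanSpace.single 0 (d 0 : ℂ) := by
      ext a
      by_cases ha : a = 0
      · subst ha
        simp [applyVec, Matrix.mulVec, dotProduct, Matrix.one_apply]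
      · have ha' : (a : ℕ) ≠ 0 := fun h => ha (Fin.ext (by simpa using h))
        simp [applyVec, Matrix.mulVec, dotProduct, Matrix.one_apply, ha', ha]
    rw [this]
    simp [abs_of_nonneg (h.nonneg 0)]
  refine ⟨hnorm, fun w => ?_⟩
  rw [htop, h.eq_mul, applyVec_mul, applyVec_mul, norm_applyVec_of_conjTranspose_mul hU]
  refine (norm_applyVec_diagonal_le h.nonneg h.antitone _).trans_eq ?_
  rw [norm_applyVec_of_conjTranspose_mul hV']

theorem applyVec_smul (A : Matrix (Fin m) (Fin n) ℂ) (c : ℂ) (v : CVec n) :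
    applyVec A (c • v) = c • applyVec A v := by
  simp [applyVec, Matrix.mulVec_smul]

theorem continuous_applyVec (A : Matrix (Fin m) (Fin n) ℂ) :
    Continuous (applyVec A : CVec n → CVec m) :=
  (Matrix.toLpLin 2 2 A).continuous_of_finiteDimensional

theorem exists_isTopSingularVector [NeZero n] (A : Matrix (Fin m) (Fin n) ℂ) :
    ∃ v, IsTopSingularVector A v := by
  obtain ⟨v, hv, hmax⟩ := (isCompact_sphere (0 : CVec n) 1).exists_isMaxOn
    (NormedSpace.sphere_nonempty.2 zero_le_one) (continuous_applyVec A).norm.continuousOn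
  refine ⟨v, mem_sphere_zero_iff_norm.1 hv, fun w => ?_⟩
  by_cases hw : w = 0
  · subst hw
    simp [applyVec]
  · have hw' : ‖w‖ ≠ 0 := norm_ne_zero_iff.2 hw
    have := hmax (a := ((‖w‖⁻¹ : ℝ) : ℂ) • w)
      (mem_sphere_zero_iff_norm.2 (by simp [norm_smul, hw']))
    simp only [Set.mem_ofPred_eq, applyVec_smul, norm_smul, Complex.norm_real, norm_inv,
      norm_norm] at this
    rwa [inv_mul_le_iff₀ (by positivity), mul_comm] at this

end SingularVector

/-! ### Measurable choice of the top singular vector -/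

section Coordinates

variable {N m n : ℕ}

/-- The entries of `N` matrices. -/
abbrev Coords (N m n : ℕ) : Type := Fin N × Fin m × Fin n → ℂ

/-- The `i`-th matrix. -/
def chan (x : Coords N m n) (i : Fin N) : Matrix (Fin m) (Fin n) ℂ :=
  Matrix.of fun a b => x (i, a, b)

/-- The operator of the `i`-th matrix, as a linear function of the entries. -/
noncomputable def chanOp (i : Fin N) : Coords N m n →ₗ[ℝ] CVec n →L[ℂ] CVec m where
  toFun x := (Matrix.toLpLin 2 2 (chan x i)).toContinuousLinearMap
  map_add' x y := by
    rw [show chan (x + y) i = chan x i + chan y i from rfl, map_add, map_add]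
  map_smul' c x := by
    rw [show chan (c • x) i = (c : ℂ) • chan x i from rfl, map_smul, map_smul]
    rfl

theorem chanOp_apply (i : Fin N) (x : Coords N m n) (v : CVec n) :
    chanOp i x v = applyVec (chan x i) v := rfl

theorem norm_chanOp {i : Fin N} {x : Coords N m n} {v : CVec n}
    (h : IsTopSingularVector (chan x i) v) : ‖chanOp i x‖ = ‖applyVec (chan x i) v‖ := by
  refine le_antisymm ((chanOp i x).opNorm_le_bound (norm_nonneg _) h.norm_le) ?_
  have := (chanOp i x).le_opNorm v
  rwa [h.norm_eq_one, mul_one] at this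

theorem lipschitzWith_norm_comp_linearMap {E F : Type*} [NormedAddCommGroup E] [NormedSpace ℝ E]
    [FiniteDimensional ℝ E] [NormedAddCommGroup F] [NormedSpace ℝ F] (L : E →ₗ[ℝ] F) :
    ∃ C, LipschitzWith C fun x => ‖L x‖ :=
  ⟨_, lipschitzWith_one_norm.comp L.toContinuousLinearMap.lipschitz⟩

/-- Rademacher's theorem: the operator norm is Lipschitz in the entries. -/
theorem ae_differentiableAt_norm_chanOp (i : Fin N) :
    ∀ᵐ x : Coords N m n, DifferentiableAt ℝ (fun y : Coords N m n => ‖chanOp i y‖) x := by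
  obtain ⟨C, hC⟩ := lipschitzWith_norm_comp_linearMap (chanOp (m := m) (n := n) i)
  exact hC.ae_differentiableAt

theorem exists_norm_eq_one_inner_eq_norm [NeZero m] (w : CVec m) :
    ∃ u : CVec m, ‖u‖ = 1 ∧ (inner ℂ u w).re = ‖w‖ := by
  by_cases hw : w = 0
  · exact ⟨EuclideanSpace.single 0 1, by simp, by simp [hw]⟩
  · have hw' : ‖w‖ ≠ 0 := norm_ne_zero_iff.2 hw
    refine ⟨((‖w‖⁻¹ : ℝ) : ℂ) • w, by simp [norm_smul, hw'], ?_⟩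
    rw [inner_smul_left, inner_self_eq_norm_sq_to_K]
    simp only [Complex.conj_ofReal, Complex.coe_algebraMap]
    norm_cast
    field_simp

/-- At a point of differentiability of the operator norm, its derivative is given by any pair of
singular vectors for the largest singular value. -/
theorem fderiv_norm_chanOp [NeZero m] {i : Fin N} {x : Coords N m n}
    (hx : DifferentiableAt ℝ (fun y : Coords N m n => ‖chanOp i y‖) x) {v : CVec n}
    (hv : IsTopSingularVector (chan x i) v) :
    ∃ u : CVec m, ‖u‖ = 1 ∧ ∀ e,
      fderiv ℝ (fun y : Coords N m n => ‖chanOp i y‖) x e = (inner ℂ u (chanOp i e v)).re := by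
  obtain ⟨u, hu, huw⟩ := exists_norm_eq_one_inner_eq_norm (applyVec (chan x i) v)
  refine ⟨u, hu, ?_⟩
  let ℓ : Coords N m n →ₗ[ℝ] ℝ :=
    { toFun := fun e => (inner ℂ u (chanOp i e v)).re
      map_add' := fun e f => by simp
      map_smul' := fun c e => by
        rw [map_smul]
        simp [inner_smul_right_eq_smul] }
  -- The operator norm dominates the functional `ℓ` everywhere and equals it at `x`, so the
  -- derivatives agree there.
  have hmin : IsLocalMin (fun y => ‖chanOp i y‖ - ℓ.toContinuousLinearMap y) x := by
    refine Filter.Eventually.of_forall fun y => ?_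
    have h₁ : ‖chanOp i x‖ - ℓ.toContinuousLinearMap x = 0 := by
      rw [norm_chanOp hv]
      exact sub_eq_zero.2 huw.symm
    refine h₁.trans_le (sub_nonneg.2 ?_)
    calc (inner ℂ u (chanOp i y v)).re ≤ ‖u‖ * ‖chanOp i y v‖ :=
          re_inner_le_norm (𝕜 := ℂ) u (chanOp i y v)
      _ ≤ ‖chanOp i y‖ := by
        simpa [hu, hv.norm_eq_one] using (chanOp i y).le_opNorm v
  have h0 := hmin.hasFDerivAt_eq_zero
    (hx.hasFDerivAt.sub ℓ.toContinuousLinearMap.hasFDerivAt)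
  intro e
  have := congrArg (fun D => D e) h0
  exact sub_eq_zero.1 this

/-- The `a`-th row of the complex matrix that represents the derivative of the operator norm. -/
noncomputable def gradRow (i : Fin N) (a : Fin m) (x : Coords N m n) : CVec n :=
  WithLp.toLp 2 fun b =>
    (fderiv ℝ (fun y : Coords N m n => ‖chanOp i y‖) x (Pi.single (i, a, b) 1) : ℂ) -
      Complex.I * fderiv ℝ (fun y : Coords N m n => ‖chanOp i y‖) x (Pi.single (i, a, b) Complex.I)

theorem measurable_gradRow (i : Fin N) (a : Fin m) :
    Measurable (gradRow i a : Coords N m n → CVec n) := by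
  refine (WithLp.measurable_toLp 2 _).comp (measurable_pi_lambda _ fun b => ?_)
  exact (Complex.measurable_ofReal.comp (measurable_fderiv_apply_const ℝ _ _)).sub
    ((Complex.measurable_ofReal.comp (measurable_fderiv_apply_const ℝ _ _)).const_mul _)

theorem applyVec_chan_single (i : Fin N) (a : Fin m) (b : Fin n) (c : ℂ) (v : CVec n) :
    applyVec (chan (Pi.single (i, a, b) c) i) v = EuclideanSpace.single a (c * v b) := by
  ext a'
  have : ∀ b', (Pi.single (i, a, b) c : Coords N m n) (i, a', b') * v b' =
      if b' = b then (if a' = a then c * v b else 0) else 0 := by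
    intro b'
    rw [Pi.single_apply]
    split_ifs <;> simp_all
  simp only [applyVec, chan, Matrix.mulVec, dotProduct, Matrix.of_apply, this,
    Finset.sum_ite_eq', Finset.mem_univ, if_true, PiLp.single_apply]

/-- With `z = conj (u a) * v b`, the derivatives along `1` and `I` are `Re z` and `-Im z`, which
`gradRow` recombines into `z`. -/
theorem gradRow_eq_smul [NeZero m] {i : Fin N} {x : Coords N m n}
    (hx : DifferentiableAt ℝ (fun y : Coords N m n => ‖chanOp i y‖) x) {v : CVec n}
    (hv : IsTopSingularVector (chan x i) v) :
    ∃ u : CVec m, ‖u‖ = 1 ∧ ∀ a, gradRow i a x = (starRingEnd ℂ (u a)) • v := by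
  obtain ⟨u, hu, hD⟩ := fderiv_norm_chanOp hx hv
  refine ⟨u, hu, fun a => ?_⟩
  ext b
  simp only [gradRow, hD, chanOp_apply, applyVec_chan_single, EuclideanSpace.inner_single_right]
  apply Complex.ext <;> simp <;> ring

/-- Almost surely the strongest right singular vector is unique up to a phase; it can be chosen
measurably. -/
theorem exists_measurable_isTopSingularVector [NeZero m] (i : Fin N) :
    ∃ g : Coords N m n → CVec n, Measurable g ∧ ∀ᵐ x : Coords N m n, ∀ v,
      IsTopSingularVector (chan x i) v → ∃ z : ℂ, ‖z‖ = 1 ∧ g x = z • v := by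
  -- Any nonzero row will do: all rows are multiples of the same `v`, and some row is nonzero
  -- because `u` is a unit vector.
  obtain ⟨g, hg, h⟩ := exists_measurable_selection
    (p := fun (a : Fin m) (x : Coords N m n) => gradRow i a x ≠ 0)
    (f := fun a x => direction (gradRow i a x))
    (fun a => (measurableSet_eq_fun (measurable_gradRow i a) measurable_const).compl)
    (fun a => measurable_direction.comp (measurable_gradRow i a))
  refine ⟨g, hg, ?_⟩
  filter_upwards [ae_differentiableAt_norm_chanOp i] with x hx v hv
  obtain ⟨u, hu, hrow⟩ := gradRow_eq_smul hx hv
  have hv0 : v ≠ 0 := norm_ne_zero_iff.1 (by simp [hv.norm_eq_one])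
  have hex : ∃ a, gradRow i a x ≠ 0 := by
    by_contra! hcon
    have : u = 0 := by
      ext a
      simpa [hrow, hv0] using hcon a
    simp [this] at hu
  obtain ⟨a, ha, hga⟩ := h x hex
  refine ⟨((‖gradRow i a x‖⁻¹ : ℝ) : ℂ) * starRingEnd ℂ (u a), ?_, ?_⟩
  · have h1 := norm_direction ha
    rw [direction, norm_smul] at h1
    rw [norm_mul, Complex.norm_real, ← h1]
    congr 1
    rw [hrow, norm_smul, hv.norm_eq_one, mul_one]
  · rw [hga, direction, mul_smul, ← hrow]
    rfl

end Coordinates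


/-! ### Null sets: norm ties and vanishing channels -/

section Generic

variable {N m n : ℕ}

theorem frobeniusNorm_chan (x : Coords N m n) (i : Fin N) :
    frobeniusNorm (chan x i) = ‖WithLp.toLp 2 fun p : Fin m × Fin n => x (i, p)‖ := by
  rw [EuclideanSpace.norm_eq, frobeniusNorm, Fintype.sum_prod_type]
  rfl

theorem measurable_frobeniusNorm_chan (i : Fin N) :
    Measurable fun x : Coords N m n => frobeniusNorm (chan x i) := by
  simp_rw [frobeniusNorm_chan]
  exact ((WithLp.measurable_toLp 2 _).comp (by fun_prop)).norm

/-- The absolute difference of the two norms is Lipschitz, hence differentiable almost everywhere.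
At a tie with nonzero norm, rescaling only the `i`-th matrix makes it a positive multiple of `|t|`,
which is not differentiable at zero. -/
theorem ae_frobeniusNorm_chan_ne [NeZero m] [NeZero n] {i j : Fin N} (hij : i ≠ j) :
    ∀ᵐ x : Coords N m n, frobeniusNorm (chan x i) ≠ frobeniusNorm (chan x j) := by
  let S : Fin N → Coords N m n →ₗ[ℝ] EuclideanSpace ℂ (Fin m × Fin n) := fun i =>
    { toFun := fun x => WithLp.toLp 2 fun p => x (i, p)
      map_add' := fun _ _ => rfl
      map_smul' := fun _ _ => rfl }
  have hS : ∀ i x p, S i x p = x (i, p) := fun _ _ _ => rfl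
  obtain ⟨C₁, hC₁⟩ := lipschitzWith_norm_comp_linearMap (S i)
  obtain ⟨C₂, hC₂⟩ := lipschitzWith_norm_comp_linearMap (S j)
  have hdiff := (lipschitzWith_one_norm.comp (hC₁.sub hC₂)).ae_differentiableAt
    (μ := (volume : Measure (Coords N m n)))
  have hne : ∀ᵐ x : Coords N m n, x (i, 0, 0) ≠ 0 :=
    Measure.ae_eval_ne (μ := fun _ => volume) (i, 0, 0) 0
  filter_upwards [hdiff, hne] with x hx h0
  simp only [frobeniusNorm_chan]
  change ‖S i x‖ ≠ ‖S j x‖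
  intro htie
  have hc : ‖S i x‖ ≠ 0 := by
    refine norm_ne_zero_iff.2 fun h => h0 ?_
    exact congrArg (fun y : EuclideanSpace ℂ (Fin m × Fin n) => y (0, 0)) h
  let e : Coords N m n := fun p => if p.1 = i then x p else 0
  have hSi : ∀ t : ℝ, S i (x + t • e) = (1 + t) • S i x := by
    intro t
    ext p
    simp [hS, e, add_mul]
  have hSj : ∀ t : ℝ, S j (x + t • e) = S j x := by
    intro t
    ext p
    simp [hS, e, hij.symm]
  have hline : DifferentiableAt ℝ (fun t : ℝ => x + t • e) 0 := by fun_prop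
  have hcomp := DifferentiableAt.comp (𝕜 := ℝ) (0 : ℝ) (by simpa using hx) hline
  have habs : (fun t : ℝ => |t|) =ᶠ[nhds 0] fun t => ‖S i x‖⁻¹ *
      ((norm ∘ fun x => ‖S i x‖ - ‖S j x‖) ∘ fun t : ℝ => x + t • e) t := by
    filter_upwards [lt_mem_nhds (show (-1 : ℝ) < 0 by norm_num)] with t ht
    simp only [Function.comp_apply, hSi, hSj, norm_smul, ← htie]
    rw [Real.norm_of_nonneg (by linarith : 0 ≤ 1 + t),
      show (1 + t) * ‖S i x‖ - ‖S i x‖ = t * ‖S i x‖ by ring, norm_mul, norm_norm,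
      Real.norm_eq_abs]
    field_simp
  exact not_differentiableAt_abs_zero
    (((differentiableAt_const _).mul hcomp).congr_of_eventuallyEq habs)

theorem measurable_applyVec_chan {α : Type*} [MeasurableSpace α] (i : Fin N)
    {f : α → Coords N m n} (hf : Measurable f) {b : α → CVec n} (hb : Measurable b) :
    Measurable fun a => applyVec (chan (f a) i) (b a) := by
  refine (WithLp.measurable_toLp 2 _).comp (measurable_pi_lambda _ fun a' => ?_)
  simp only [chan, Matrix.mulVec, dotProduct, Matrix.of_apply]
  fun_prop

/-- The exceptional set is a proper linear subspace, hence null; a matrix with a single entry placed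
against a nonzero coordinate of `b` lies outside it. -/
theorem ae_applyVec_chan_ne_zero [NeZero m] (i : Fin N) {b : CVec n} (hb : b ≠ 0) :
    ∀ᵐ x : Coords N m n, applyVec (chan x i) b ≠ 0 := by
  let L : Coords N m n →ₗ[ℝ] CVec m :=
    { toFun := fun x => chanOp i x b
      map_add' := fun x y => by simp
      map_smul' := fun c x => by simp }
  have hL : LinearMap.ker L ≠ ⊤ := by
    obtain ⟨b₀, hb₀⟩ : ∃ b₀, b b₀ ≠ 0 := by
      by_contra! h
      exact hb (by ext b₀; exact h b₀)
    intro htop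
    have : applyVec (chan (Pi.single (i, 0, b₀) 1 : Coords N m n) i) b = 0 :=
      LinearMap.mem_ker.1 (htop ▸ Submodule.mem_top : Pi.single (i, 0, b₀) 1 ∈ LinearMap.ker L)
    rw [applyVec_chan_single] at this
    have := congrArg (fun y : CVec m => y 0) this
    simp [hb₀] at this
  have := Measure.addHaar_submodule (volume : Measure (Coords N m n)) _ hL
  rw [ae_iff]
  refine measure_mono_null (fun x hx => ?_) this
  exact not_not.1 hx

end Generic

/-! ### Left multiplication of the channels by unitaries -/

section RotateChannels

variable {N m n : ℕ}

/-- Left multiplication of a matrix by a unitary operator. -/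
noncomputable def rotateMatrix (T : CVec m ≃ₗᵢ[ℂ] CVec m) (A : Matrix (Fin m) (Fin n) ℂ) :
    Matrix (Fin m) (Fin n) ℂ :=
  Matrix.of fun a b => T (WithLp.toLp 2 fun a' => A a' b) a

theorem applyVec_eq_sum (A : Matrix (Fin m) (Fin n) ℂ) (v : CVec n) :
    applyVec A v = ∑ b, v b • (WithLp.toLp 2 fun a => A a b : CVec m) := by
  ext a
  simp [applyVec, Matrix.mulVec, dotProduct, mul_comm]

theorem applyVec_rotateMatrix (T : CVec m ≃ₗᵢ[ℂ] CVec m) (A : Matrix (Fin m) (Fin n) ℂ)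
    (v : CVec n) : applyVec (rotateMatrix T A) v = T (applyVec A v) := by
  rw [applyVec_eq_sum, applyVec_eq_sum, map_sum]
  simp only [map_smul]
  rfl

theorem sum_norm_sq_rotateMatrix (T : CVec m ≃ₗᵢ[ℂ] CVec m) (A : Matrix (Fin m) (Fin n) ℂ) :
    ∑ a, ∑ b, ‖rotateMatrix T A a b‖ ^ 2 = ∑ a, ∑ b, ‖A a b‖ ^ 2 := by
  rw [Finset.sum_comm, Finset.sum_comm (f := fun a b => ‖A a b‖ ^ 2)]
  refine Finset.sum_congr rfl fun b _ => ?_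
  have h := congrArg (· ^ 2) (T.norm_map (WithLp.toLp 2 fun a' => A a' b))
  simp only [EuclideanSpace.norm_sq_eq] at h
  exact h

theorem frobeniusNorm_rotateMatrix (T : CVec m ≃ₗᵢ[ℂ] CVec m) (A : Matrix (Fin m) (Fin n) ℂ) :
    frobeniusNorm (rotateMatrix T A) = frobeniusNorm A := by
  rw [frobeniusNorm, sum_norm_sq_rotateMatrix, frobeniusNorm]

theorem isTopSingularVector_rotateMatrix {T : CVec m ≃ₗᵢ[ℂ] CVec m} {A : Matrix (Fin m) (Fin n) ℂ}
    {v : CVec n} (h : IsTopSingularVector A v) : IsTopSingularVector (rotateMatrix T A) v :=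
  ⟨h.norm_eq_one, fun w => by simpa only [applyVec_rotateMatrix, T.norm_map] using h.norm_le w⟩

/-- Left multiplication of each of the matrices by a unitary operator. -/
noncomputable def rotateChannels (S : Fin N → CVec m ≃ₗᵢ[ℂ] CVec m) :
    Coords N m n →ₗ[ℝ] Coords N m n where
  toFun x p := rotateMatrix (S p.1) (chan x p.1) p.2.1 p.2.2
  map_add' x y := by
    funext p
    exact congrArg (fun w : CVec m => w p.2.1) ((S p.1).map_add
      (WithLp.toLp 2 fun a => x (p.1, a, p.2.2)) (WithLp.toLp 2 fun a => y (p.1, a, p.2.2)))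
  map_smul' c x := by
    funext p
    exact congrArg (fun w : CVec m => w p.2.1) ((S p.1).map_smul (c : ℂ)
      (WithLp.toLp 2 fun a => x (p.1, a, p.2.2)))

theorem chan_rotateChannels (S : Fin N → CVec m ≃ₗᵢ[ℂ] CVec m) (x : Coords N m n) (i : Fin N) :
    chan (rotateChannels S x) i = rotateMatrix (S i) (chan x i) := rfl

/-- A unitary preserves the norm of each column, hence the total sum of squares, on which the
Gaussian invariance rests. -/
theorem measurePreserving_rotateChannels (S : Fin N → CVec m ≃ₗᵢ[ℂ] CVec m) :
    MeasurePreserving (rotateChannels S : Coords N m n → Coords N m n)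
      (Measure.pi fun _ => complexGaussian) (Measure.pi fun _ => complexGaussian) := by
  refine measurePreserving_pi_complexGaussian _ fun x => ?_
  simp only [Fintype.sum_prod_type]
  exact Finset.sum_congr rfl fun i _ => sum_norm_sq_rotateMatrix (S i) (chan x i)

end RotateChannels

/-! ### Invariance of the beamforming scheme -/

section Scheme

variable {N m n s K : ℕ}

/-- `g` represents, up to phases, the strongest right singular vectors of the matrices. -/
def RepresentsTop (g : Fin N → Coords N m n → CVec n) (x : Coords N m n) : Prop :=
  ∀ i v, IsTopSingularVector (chan x i) v → ∃ z : ℂ, ‖z‖ = 1 ∧ g i x = z • v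

/-- The equivalent channels in terms of the entries, of a sorting permutation and of representatives
of the strongest right singular vectors. -/
def equivChannels (hs : s ≤ N) (φ : (Fin K → Fin s → CVec n) → (Fin s → CVec n) → Fin K)
    (g : Fin N → Coords N m n → CVec n) (σ : Equiv.Perm (Fin N))
    (q : Coords N m n × (Fin K → Fin s → CVec n)) (k : Fin s) : CVec m :=
  applyVec (chan q.1 (σ (Fin.rev (Fin.castLE hs k))))
    (q.2 (φ q.2 fun l => g (σ (Fin.rev (Fin.castLE hs l))) q.1) k)

theorem measurable_equivChannels (hs : s ≤ N)
    {φ : (Fin K → Fin s → CVec n) → (Fin s → CVec n) → Fin K} (hφ : IsQuantizer φ)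
    {g : Fin N → Coords N m n → CVec n} (hg : ∀ i, Measurable (g i)) (σ : Equiv.Perm (Fin N)) :
    Measurable (equivChannels hs φ g σ) := by
  refine measurable_pi_lambda _ fun k => ?_
  refine measurable_applyVec_chan _ measurable_fst ?_
  have hsel : Measurable fun p : Fin K × (Fin K → Fin s → CVec n) => p.2 p.1 k :=
    measurable_from_prod_countable_right fun j => by fun_prop
  refine hsel.comp (Measurable.prodMk ?_ measurable_snd)
  exact hφ.measurable.comp (measurable_snd.prodMk
    (measurable_pi_lambda _ fun l => (hg _).comp measurable_fst))

/-- This removes the dependence on which decomposition was picked: all top singular vectors at `x`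
span the line of `g`. -/
theorem quantizer_eq_of_representsTop
    {φ : (Fin K → Fin s → CVec n) → (Fin s → CVec n) → Fin K} (hφ : IsQuantizer φ)
    {g : Fin N → Coords N m n → CVec n} {x : Coords N m n} (hx : RepresentsTop g x)
    {B : Fin K → Fin s → CVec n} (hB : ∀ j k, ‖B j k‖ = 1) {i : Fin s → Fin N}
    {v : Fin s → CVec n} (hv : ∀ k, IsTopSingularVector (chan x (i k)) (v k)) :
    (φ B fun k => g (i k) x) = φ B v := by
  choose z hz hgz using fun k => hx (i k) (v k) (hv k)
  simp only [hgz]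
  exact hφ.phase_invariant B v hB (fun k => (hv k).norm_eq_one) z hz

/-- The vector of the Frobenius norms of the matrices. -/
noncomputable def frobeniusNorms (x : Coords N m n) : Fin N → ℝ := fun i => frobeniusNorm (chan x i)

theorem measurable_frobeniusNorms : Measurable (frobeniusNorms : Coords N m n → Fin N → ℝ) :=
  measurable_pi_lambda _ measurable_frobeniusNorm_chan

theorem frobeniusNorms_rotateChannels (S : Fin N → CVec m ≃ₗᵢ[ℂ] CVec m) (x : Coords N m n) :
    frobeniusNorms (rotateChannels S x) = frobeniusNorms x := by
  funext i
  rw [frobeniusNorms, chan_rotateChannels, frobeniusNorm_rotateMatrix, frobeniusNorms]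

/-- Selects among finitely many permutations; `Tuple.sort` only witnesses that a sorting one exists.
-/
theorem exists_measurable_sort (N : ℕ) [MeasurableSpace (Equiv.Perm (Fin N))] :
    ∃ ρ : (Fin N → ℝ) → Equiv.Perm (Fin N), Measurable ρ ∧ ∀ y, Monotone (y ∘ ρ y) := by
  obtain ⟨ρ, hρ, h⟩ := exists_measurable_selection
    (p := fun (σ : Equiv.Perm (Fin N)) (y : Fin N → ℝ) => Monotone (y ∘ σ))
    (f := fun σ _ => σ) (fun σ => by
      simp only [Monotone, Set.ofPred_forall]
      exact .iInter fun a => .iInter fun b => .iInter fun _ =>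
        measurableSet_le (measurable_pi_apply _) (measurable_pi_apply _))
    (fun σ => measurable_const)
  refine ⟨ρ, hρ, fun y => ?_⟩
  obtain ⟨σ, hσ, e⟩ := h y ⟨Tuple.sort y, Tuple.monotone_sort y⟩
  rwa [e]

/-- By Fubini the codebook may be fixed. Covering every matrix and every codeword makes the later
data-dependent choices harmless. -/
theorem ae_forall_applyVec_ne_zero [NeZero m] {ν : Measure (Fin K → Fin s → CVec n)} [SFinite ν]
    (hν : ∀ᵐ B ∂ν, ∀ j k, ‖B j k‖ = 1) :
    ∀ᵐ q ∂((Measure.pi fun _ : Fin N × Fin m × Fin n => complexGaussian).prod ν),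
      ∀ i j k, applyVec (chan q.1 i) (q.2 j k) ≠ 0 := by
  simp only [ae_all_iff]
  intro i j k
  have hms : MeasurableSet {q : Coords N m n × (Fin K → Fin s → CVec n) |
      applyVec (chan q.1 i) (q.2 j k) = 0} :=
    measurableSet_eq_fun (measurable_applyVec_chan i measurable_fst (by fun_prop))
      measurable_const
  rw [ae_iff]
  simp only [not_not]
  rw [Measure.prod_apply_symm hms,
    lintegral_eq_zero_iff' (measurable_measure_prodMk_right hms).aemeasurable]
  filter_upwards [hν] with B hB
  have hb : B j k ≠ 0 := norm_ne_zero_iff.1 (by simp [hB j k])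
  have := (pi_absolutelyContinuous complexGaussian_absolutelyContinuous _).ae_le
    (ae_applyVec_chan_ne_zero (N := N) (m := m) i hb)
  simpa [mem_ae_iff, Set.compl_def] using this

/-- The same vectors `v` are top singular vectors before and after the rotation, so the codeword
index is unchanged. -/
theorem equivChannels_rotateChannels [NeZero n] (hs : s ≤ N)
    {φ : (Fin K → Fin s → CVec n) → (Fin s → CVec n) → Fin K} (hφ : IsQuantizer φ)
    {g : Fin N → Coords N m n → CVec n} (σ : Equiv.Perm (Fin N))
    (S : Fin N → CVec m ≃ₗᵢ[ℂ] CVec m) {x : Coords N m n} (hx : RepresentsTop g x)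
    (hSx : RepresentsTop g (rotateChannels S x)) {B : Fin K → Fin s → CVec n}
    (hB : ∀ j k, ‖B j k‖ = 1) (k : Fin s) :
    equivChannels hs φ g σ (rotateChannels S x, B) k =
      S (σ (Fin.rev (Fin.castLE hs k))) (equivChannels hs φ g σ (x, B) k) := by
  choose v hv using fun l : Fin s =>
    exists_isTopSingularVector (chan x (σ (Fin.rev (Fin.castLE hs l))))
  have e₁ := quantizer_eq_of_representsTop hφ hx hB hv
  have e₂ := quantizer_eq_of_representsTop hφ hSx hB (v := v) (i := fun l =>
    σ (Fin.rev (Fin.castLE hs l))) fun k => by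
      rw [chan_rotateChannels]
      exact isTopSingularVector_rotateMatrix (hv k)
  simp only [equivChannels]
  rw [e₁, e₂, chan_rotateChannels, applyVec_rotateMatrix]

variable [MeasurableSpace (Equiv.Perm (Fin N))] [DiscreteMeasurableSpace (Equiv.Perm (Fin N))]
  {hs : s ≤ N} {φ : (Fin K → Fin s → CVec n) → (Fin s → CVec n) → Fin K}
  {g : Fin N → Coords N m n → CVec n} {ρ : (Fin N → ℝ) → Equiv.Perm (Fin N)}

theorem measurable_equivChannels_sort (hφ : IsQuantizer φ) (hg : ∀ i, Measurable (g i))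
    (hρ : Measurable ρ) :
    Measurable fun q : Coords N m n × (Fin K → Fin s → CVec n) =>
      equivChannels hs φ g (ρ (frobeniusNorms q.1)) q := by
  have hσ : Measurable fun q : Coords N m n × (Fin K → Fin s → CVec n) =>
      ρ (frobeniusNorms q.1) := hρ.comp (measurable_frobeniusNorms.comp measurable_fst)
  exact measurable_comp_countable hσ fun σ => measurable_equivChannels hs hφ hg σ

theorem map_rotate_map_equivChannels [NeZero n] (hφ : IsQuantizer φ) (hg : ∀ i, Measurable (g i))
    (hρ : Measurable ρ) (hgx : ∀ᵐ x : Coords N m n, RepresentsTop g x)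
    {ν : Measure (Fin K → Fin s → CVec n)} [SFinite ν] (hν : ∀ᵐ B ∂ν, ∀ j k, ‖B j k‖ = 1)
    (T : Fin s → CVec m ≃ₗᵢ[ℂ] CVec m) :
    ((((Measure.pi fun _ => complexGaussian).prod ν).map fun q =>
      equivChannels hs φ g (ρ (frobeniusNorms q.1)) q).map (rotate T)) =
    ((Measure.pi fun _ => complexGaussian).prod ν).map fun q =>
      equivChannels hs φ g (ρ (frobeniusNorms q.1)) q := by
  -- `S` is indexed by position in increasing order, so `T k` sits at the reversed position;
  -- unselected users get the identity.
  let S : Fin N → CVec m ≃ₗᵢ[ℂ] CVec m := fun j =>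
    if h : (Fin.rev j : ℕ) < s then T ⟨Fin.rev j, h⟩ else LinearIsometryEquiv.refl ℂ _
  have hS : ∀ k, S (Fin.rev (Fin.castLE hs k)) = T k := by
    intro k
    have : ((Fin.rev (Fin.rev (Fin.castLE hs k)) : Fin N) : ℕ) < s := by
      rw [Fin.rev_rev]
      exact k.2
    simp only [S, dif_pos this]
    congr 1
    ext
    simp only [Fin.rev_rev, Fin.val_castLE]
  -- User `i` occupies position `σ.symm i` in the order `σ`.
  let θ : Equiv.Perm (Fin N) → Coords N m n → Coords N m n := fun σ =>
    rotateChannels fun i => S (σ.symm i)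
  have hnorms : ∀ σ x, frobeniusNorms (θ σ x) = frobeniusNorms x :=
    fun σ => frobeniusNorms_rotateChannels _
  let Θ : Coords N m n → Coords N m n := fun x => θ (ρ (frobeniusNorms x)) x
  have hΘ : MeasurePreserving Θ (Measure.pi fun _ => complexGaussian)
      (Measure.pi fun _ => complexGaussian) :=
    measurePreserving_glue (π := fun x => ρ (frobeniusNorms x)) (θ := θ)
      (hρ.comp measurable_frobeniusNorms) (fun σ => measurePreserving_rotateChannels _) fun σ x =>
        congrArg ρ (hnorms σ x)
  have hΘν := hΘ.prod (MeasurePreserving.id ν)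
  have hgγ : ∀ᵐ x ∂(Measure.pi fun _ => complexGaussian), RepresentsTop g x :=
    (pi_absolutelyContinuous complexGaussian_absolutelyContinuous _).ae_le hgx
  have hae : ∀ᵐ q ∂((Measure.pi fun _ => complexGaussian).prod ν),
      rotate T (equivChannels hs φ g (ρ (frobeniusNorms q.1)) q) =
        equivChannels hs φ g (ρ (frobeniusNorms (Prod.map Θ id q).1)) (Prod.map Θ id q) := by
    have h₁ : ∀ᵐ q ∂((Measure.pi fun _ => complexGaussian).prod ν), RepresentsTop g q.1 :=
      Measure.quasiMeasurePreserving_fst.ae hgγ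
    -- `g` need not be equivariant; it represents the top vectors at the rotated point because `Θ`
    -- preserves null sets.
    have h₂ : ∀ᵐ q ∂((Measure.pi fun _ => complexGaussian).prod ν), RepresentsTop g (Θ q.1) :=
      Measure.quasiMeasurePreserving_fst.ae (hΘ.quasiMeasurePreserving.ae hgγ)
    have h₃ : ∀ᵐ q ∂((Measure.pi fun _ : Fin N × Fin m × Fin n => complexGaussian).prod ν),
        ∀ j k, ‖q.2 j k‖ = 1 := Measure.quasiMeasurePreserving_snd.ae hν
    filter_upwards [h₁, h₂, h₃] with q h₁ h₂ hB
    have hσ : ρ (frobeniusNorms (Prod.map Θ id q).1) = ρ (frobeniusNorms q.1) :=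
      congrArg ρ (hnorms _ _)
    rw [hσ]
    funext k
    refine Eq.trans ?_ (equivChannels_rotateChannels hs hφ _ _ h₁ h₂ hB k).symm
    rw [Equiv.symm_apply_apply, hS]
    rfl
  have hm := measurable_equivChannels_sort (hs := hs) hφ hg hρ
  rw [Measure.map_map (measurable_rotate T) hm]
  conv_rhs => rw [← hΘν.map_eq, Measure.map_map hm hΘν.measurable]
  exact Measure.map_congr hae

end Scheme


/-! ### Almost sure uniqueness of the order, and conclusion -/

theorem IsSorting.eq_of_injective {m n N : ℕ} {A : Fin N → Matrix (Fin m) (Fin n) ℂ}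
    {σ τ : Equiv.Perm (Fin N)} (hσ : IsSorting A σ) (hτ : IsSorting A τ)
    (hA : Function.Injective fun i => frobeniusNorm (A i)) : σ = τ := by
  have h : (fun i => frobeniusNorm (A i)) ∘ σ = (fun i => frobeniusNorm (A i)) ∘ τ :=
    Tuple.unique_monotone hσ hτ
  exact Equiv.ext fun i => hA (congrFun h i)

theorem ae_injective_frobeniusNorm_chan {N m n : ℕ} [NeZero m] [NeZero n] :
    ∀ᵐ x : Coords N m n, Function.Injective fun i => frobeniusNorm (chan x i) := by
  have h : ∀ᵐ x : Coords N m n, ∀ i j, i ≠ j →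
      frobeniusNorm (chan x i) ≠ frobeniusNorm (chan x j) :=
    ae_all_iff.2 fun i => ae_all_iff.2 fun j =>
      Filter.eventually_imp_distrib_left.2 fun hij => ae_frobeniusNorm_chan_ne hij
  filter_upwards [h] with x hx i j hij
  by_contra hne
  exact hx i j hne hij

end Beamforming

theorem theorem4 {Ω : Type*} [MeasurableSpace Ω] (P : Measure Ω) [IsProbabilityMeasure P]
    (LR LT N s K : ℕ) [NeZero LR] [NeZero LT] (hs : s ≤ N)
    -- the channel matrices and the random code book, which are independent
    (H : Fin N → Ω → Matrix (Fin LR) (Fin LT) ℂ) (hH : Beamforming.IsRayleighFading H P)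
    (C : Ω → Fin K → Fin s → Beamforming.CVec LT) (hC : Beamforming.IsIsotropicCodebook C P)
    (hHC : IndepFun (fun ω (p : Fin N × Fin LR × Fin LT) => H p.1 ω p.2.1 p.2.2) C P)
    -- selection of the `s` users whose channel matrices have the largest Frobenius norms
    (τ : Ω → Equiv.Perm (Fin N)) (hτ : ∀ ω, Beamforming.IsSorting (fun i => H i ω) (τ ω))
    -- singular value decompositions of the selected channel matrices
    (U : Ω → Fin s → Matrix (Fin LR) (Fin LR) ℂ) (d : Ω → Fin s → ℕ → ℝ)
    (V : Ω → Fin s → Matrix (Fin LT) (Fin LT) ℂ)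
    (hSVD : ∀ ω k, Beamforming.IsSVD (Beamforming.selected hs (fun i => H i ω) (τ ω) k)
      (U ω k) (d ω k) (V ω k))
    -- joint quantization of the strongest eigen-channel vectors
    (φ : (Fin K → Fin s → Beamforming.CVec LT) → (Fin s → Beamforming.CVec LT) → Fin K)
    (hφ : Beamforming.IsQuantizer φ)
    -- equivalent channels, their norms and their directions
    (h : Fin s → Ω → Beamforming.CVec LR)
    (hh : ∀ k ω, h k ω = Beamforming.equivChannel hs φ (fun i => H i ω) (τ ω) (V ω) (C ω) k)
    (n : Fin s → Ω → ℝ) (hn : ∀ k ω, n k ω = ‖h k ω‖)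
    (ξ : Fin s → Ω → Beamforming.CVec LR) (hξ : ∀ k ω, ξ k ω = Beamforming.direction (h k ω)) :
    (∀ k, Beamforming.IsotropicallyDistributed (ξ k) P) ∧
    iIndepFun ξ P ∧
    IndepFun (fun ω k => ξ k ω) (fun ω k => n k ω) P := by
  let _ : MeasurableSpace (Equiv.Perm (Fin N)) := ⊤
  have _ : DiscreteMeasurableSpace (Equiv.Perm (Fin N)) := ⟨fun _ => trivial⟩
  obtain ⟨ρ, hρ, hρ_mono⟩ := Beamforming.exists_measurable_sort N
  choose g hg hg_top using
    Beamforming.exists_measurable_isTopSingularVector (N := N) (m := LR) (n := LT)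
  have hgx : ∀ᵐ x : Beamforming.Coords N LR LT, Beamforming.RepresentsTop g x :=
    ae_all_iff.2 hg_top
  -- the law of the entries and of the code book
  have hx_law : HasLaw (fun ω (p : Fin N × Fin LR × Fin LT) => H p.1 ω p.2.1 p.2.2)
      (Measure.pi fun _ => Beamforming.complexGaussian) P :=
    hH.iIndepFun.hasLaw_pi fun p => hH.hasLaw p.1 p.2.1 p.2.2
  have hC_meas : AEMeasurable C P :=
    aemeasurable_pi_lambda _ fun j => aemeasurable_pi_lambda _ fun k =>
      (hC.isotropic j k).aemeasurable
  have : IsProbabilityMeasure (P.map C) := Measure.isProbabilityMeasure_map hC_meas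
  have hC_norm : ∀ᵐ ω ∂P, ∀ j k, ‖C ω j k‖ = 1 := by
    refine ae_all_iff.2 fun j => ae_all_iff.2 fun k => ?_
    filter_upwards [ae_of_ae_map (hC.isotropic j k).aemeasurable
      (hC.isotropic j k).isIsotropic.ae_mem_sphere] with ω hω
    exact mem_sphere_zero_iff_norm.1 hω
  have hν : ∀ᵐ B ∂(P.map C), ∀ j k, ‖B j k‖ = 1 := by
    refine (ae_map_iff hC_meas ?_).2 hC_norm
    simp only [Set.ofPred_forall]
    exact .iInter fun j => .iInter fun k => measurableSet_eq_fun (by fun_prop) measurable_const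
  have hX_meas := hx_law.aemeasurable.prodMk hC_meas
  have hX := (indepFun_iff_map_prod_eq_prod_map_map hx_law.aemeasurable hC_meas).1 hHC
  rw [hx_law.map_eq] at hX
  have hx_ae : ∀ {p : Beamforming.Coords N LR LT → Prop}, (∀ᵐ x, p x) →
      ∀ᵐ ω ∂P, p fun q => H q.1 ω q.2.1 q.2.2 := by
    intro p hp
    refine ae_of_ae_map hx_law.aemeasurable ?_
    rw [hx_law.map_eq]
    exact (Beamforming.pi_absolutelyContinuous
      Beamforming.complexGaussian_absolutelyContinuous _).ae_le hp
  -- the equivalent channels coincide almost surely with a measurable function of these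
  have hae : (fun ω k => h k ω) =ᵐ[P] (fun q => Beamforming.equivChannels hs φ g
      (ρ (Beamforming.frobeniusNorms q.1)) q) ∘
        fun ω => (fun (p : Fin N × Fin LR × Fin LT) => H p.1 ω p.2.1 p.2.2, C ω) := by
    filter_upwards [hC_norm, hx_ae hgx, hx_ae Beamforming.ae_injective_frobeniusNorm_chan]
      with ω hB hg_ω hinj
    -- Without ties the sorting permutation is unique, so the arbitrary `τ` agrees with the
    -- measurable `ρ`.
    have hσ : τ ω = ρ (Beamforming.frobeniusNorms
        fun (p : Fin N × Fin LR × Fin LT) => H p.1 ω p.2.1 p.2.2) :=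
      Beamforming.IsSorting.eq_of_injective (hτ ω) (hρ_mono (Beamforming.frobeniusNorms
        fun (p : Fin N × Fin LR × Fin LT) => H p.1 ω p.2.1 p.2.2)) hinj
    have hsel := Beamforming.quantizer_eq_of_representsTop hφ hg_ω hB
      (i := fun l => τ ω (Fin.rev (Fin.castLE hs l)))
      fun l => Beamforming.isTopSingularVector_firstColumn (hSVD ω l)
    funext k
    simp only [hh, Function.comp_apply, Beamforming.equivChannels, ← hσ, hsel]
    rfl
  have hG := Beamforming.measurable_equivChannels_sort (m := LR) (hs := hs) hφ hg hρ
  -- Measurability comes only through the almost sure equality, since `τ` and `V` may be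
  -- nonmeasurable.
  have hm : AEMeasurable (fun ω k => h k ω) P := (hG.comp_aemeasurable hX_meas).congr hae.symm
  have hmap : P.map (fun ω k => h k ω) =
      ((Measure.pi fun _ => Beamforming.complexGaussian).prod (P.map C)).map fun q =>
        Beamforming.equivChannels hs φ g (ρ (Beamforming.frobeniusNorms q.1)) q := by
    rw [Measure.map_congr hae, ← hX, AEMeasurable.map_map_of_aemeasurable hG.aemeasurable hX_meas]
  have h0 : ∀ᵐ ω ∂P, ∀ k, h k ω ≠ 0 := by
    have := Beamforming.ae_forall_applyVec_ne_zero (N := N) (m := LR) hν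
    rw [← hX] at this
    filter_upwards [ae_of_ae_map hX_meas this] with ω hω k
    rw [hh]
    exact hω _ _ _
  have hmain := Beamforming.isotropic_iIndepFun_indepFun_norm hm (fun T => by
    rw [hmap]
    exact Beamforming.map_rotate_map_equivChannels hφ hg hρ hgx hν T) h0
  obtain rfl : ξ = fun k ω => Beamforming.direction (h k ω) :=
    funext fun k => funext fun ω => hξ k ω
  obtain rfl : n = fun k ω => ‖h k ω‖ := funext fun k => funext fun ω => hn k ω
  exact hmain
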